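/- Let $n\ge 1$, let $\lambda_0\ge\lambda_1\ge\dots\ge\lambda_{n-1}\ge 0$, $\Sigma=\mathrm{diag}(\lambda_0,\dots,\lambda_{n-1})$, and let $x\sim\mathcal N(0,\Sigma)$ be a (single use of a) memoryless Gaussian source in $\mathbb R^n$. A stochastic encoding mapping is a Markov kernel $f_{\hat x|x}$ from $\mathbb R^n$ to $\mathbb R^n$, giving the conditional law of the reconstruction $\hat x$ given $x$; for $\delta\ge 0$ put $$\rho(\delta)=\inf_{f_{\hat x|x}}\{\, I(\hat x;x)\ :\ D=\mathbb E\|x-\hat x\|^2\le\delta\,\},$$ where $I(\hat x;x)\in[0,\infty]$ is the mutual information in bits. A mapping is called optimal for $\delta$ if it satisfies $D\le\delta$ and $I(\hat x;x)=\rho(\delta)$. Let $0\le\delta\le\sum_{j}\lambda_j$. Then there is exactly one $\theta\in[0,\lambda_0]$ (the reverse water-filling parameter) with $\delta=\sum_{j=0}^{n-1}\min\{\theta,\lambda_j\}$. Put $\tau_j=\min\{1,\theta/\lambda_j\}$ if $\lambda_j>0$ and $\tau_j=1$ if $\lambda_j=0$, $T_\theta=\mathrm{diag}(\tau_0,\dots,\tau_{n-1})$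 and $S_\theta=I_n-T_\theta$. A Gaussian law with singular covariance matrix is understood as the corresponding degenerate one (a Dirac delta along the directions of zero variance). Then the mapping under which $\hat x$ given $x=\beta$ has law $$f_{\hat x|x}(\cdot\,|\,\beta)=\mathcal N(S_\theta\beta,\ \Sigma S_\theta T_\theta)$$ is optimal for $\delta$; every mapping that is optimal for $\delta$ coincides with it for almost every $\beta$ with respect to the law of $x$; and for the optimal mapping the reconstruction has law $\hat x\sim\mathcal N(0,\Sigma S_\theta)$. -/

import Mathlib

open MeasureTheory ProbabilityTheory
open scoped ENNReal Matrix

namespace RateDistortion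

section General

variable {E : Type*} [NormedAddCommGroup E] [MeasurableSpace E]

/-- The mutual information, in bits, between a source of law `μ` and its image under the stochastic
mapping `κ`: the Kullback-Leibler divergence of the joint law of `(x, x̂)` from the product of the
two marginal laws. -/
noncomputable def mutualInfo (μ : Measure E) (κ : Kernel E E) : ℝ≥0∞ :=
  InformationTheory.klDiv (μ ⊗ₘ κ) (μ.prod (κ ∘ₘ μ)) / ENNReal.ofReal (Real.log 2)

/-- The distortion `D = 𝔼 ‖x - x̂‖²`, where `x` has law `μ` and `x̂` is drawn from `κ x`
(infinite when the square norm is not integrable). -/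
noncomputable def distortion (μ : Measure E) (κ : Kernel E E) : ℝ≥0∞ :=
  ∫⁻ p, ENNReal.ofReal (‖p.1 - p.2‖ ^ 2) ∂(μ ⊗ₘ κ)

/-- The rate-distortion function: the infimum of the mutual information over all stochastic
mappings (Markov kernels) whose distortion is at most `δ`. -/
noncomputable def rate (μ : Measure E) (δ : ℝ) : ℝ≥0∞ :=
  ⨅ (κ : Kernel E E) (_ : IsMarkovKernel κ) (_ : distortion μ κ ≤ ENNReal.ofReal δ), mutualInfo μ κ

/-- `κ` is a rate-distortion-optimal encoding mapping for the source `μ` under the constraint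
`D ≤ δ`. -/
structure IsOptimalEncoding (μ : Measure E) (δ : ℝ) (κ : Kernel E E) : Prop where
  isMarkov : IsMarkovKernel κ
  distortion_le : distortion μ κ ≤ ENNReal.ofReal δ
  mutualInfo_eq : mutualInfo μ κ = rate μ δ

end General

/-- `θ ∈ [0, λ₀]` is the reverse water-filling parameter for the variances `l` and the distortion
level `δ`. -/
def IsReverseWaterFilling {n : ℕ} [NeZero n] (l : Fin n → ℝ) (δ θ : ℝ) : Prop :=
  θ ∈ Set.Icc 0 (l 0) ∧ δ = ∑ j, min θ (l j)

/-- The fraction `τ_j = min {1, θ / λ_j}` of energy cancelled by distortion along a component,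
with the value `1` on a component of zero variance. -/
noncomputable def tau {n : ℕ} (l : Fin n → ℝ) (θ : ℝ) (j : Fin n) : ℝ :=
  if l j = 0 then 1 else min 1 (θ / l j)

/-- `T_θ = diag (τ_0, …, τ_{n-1})`. -/
noncomputable def matT {n : ℕ} (l : Fin n → ℝ) (θ : ℝ) : Matrix (Fin n) (Fin n) ℝ :=
  Matrix.diagonal (tau l θ)

/-- `S_θ = I - T_θ`. -/
noncomputable def matS {n : ℕ} (l : Fin n → ℝ) (θ : ℝ) : Matrix (Fin n) (Fin n) ℝ :=
  1 - matT l θ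

/-- The law `N(0, Σ)` of the source, `Σ = diag (λ_0, …, λ_{n-1})`. -/
noncomputable def gaussianSource {n : ℕ} (l : Fin n → ℝ) : Measure (EuclideanSpace ℝ (Fin n)) :=
  multivariateGaussian 0 (Matrix.diagonal l)

section Measurability

open scoped MatrixOrder

theorem measurable_multivariateGaussian_mean {n : ℕ} (C : Matrix (Fin n) (Fin n) ℝ) :
    Measurable fun m : EuclideanSpace ℝ (Fin n) => multivariateGaussian m C := by
  refine Measure.measurable_of_measurable_coe _ fun s hs => ?_
  have hf : Measurable fun p : EuclideanSpace ℝ (Fin n) × EuclideanSpace ℝ (Fin n) =>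
      p.1 + Matrix.toEuclideanCLM (𝕜 := ℝ) (CFC.sqrt C) p.2 := by fun_prop
  have h := measurable_measure_prodMk_left
    (ν := stdGaussian (EuclideanSpace ℝ (Fin n))) (hf hs)
  convert h using 2 with m
  rw [multivariateGaussian, Measure.map_apply (by fun_prop) hs]; rfl

end Measurability

/-- The stochastic mapping `β ↦ N(S_θ β, Σ S_θ T_θ)`. -/
noncomputable def gaussianEncoder {n : ℕ} (l : Fin n → ℝ) (θ : ℝ) :
    Kernel (EuclideanSpace ℝ (Fin n)) (EuclideanSpace ℝ (Fin n)) where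
  toFun β := multivariateGaussian (WithLp.toLp 2 (matS l θ *ᵥ β.ofLp))
    (Matrix.diagonal l * matS l θ * matT l θ)
  measurable' := (measurable_multivariateGaussian_mean _).comp (by fun_prop)

end RateDistortion

/-! For θ > 0, a single test function certifies both optimality and uniqueness. `infoDensity` is, on
a component with λ_j ≥ θ, the log-ratio of the densities N(y_j, θ) and N(0, λ_j) at x_j; on a lower
component, λ_j in this formula is replaced by θ. Its exponential has integral at most 1 against the
source times any reconstruction law, so the Donsker-Varadhan bound gives I ≥ 𝔼 f. Only the
distortion makes 𝔼 f depend on the mapping: it equals the water-filling rate plus (δ - D)/(2θ), so D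
≤ δ yields the converse.

The Gaussian mapping attains the bound, because its joint law is the product of its marginals tilted
by f. Conversely, equality forces such a tilting and a reconstruction that vanishes below the water
level. The tilted law describes x as x̂ plus independent Gaussian noise with variances min(θ, λ_j).
Since the law of x is known and the noise characteristic function never vanishes, deconvolution
determines the law of x̂, hence the joint law, hence the mapping almost everywhere.

For θ = 0 the density is meaningless, but then D = 0 and x̂ = x almost surely. -/

namespace RateDistortion

/-! ### Donsker-Varadhan bound and its equality case. -/

section Gibbs

variable {α : Type*} {mα : MeasurableSpace α} {P Q : Measure α} {f : α → ℝ}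

/-- The Donsker-Varadhan lower bound on the Kullback-Leibler divergence. -/
theorem ofReal_integral_le_klDiv [IsProbabilityMeasure P] [IsProbabilityMeasure Q]
    (hf : Integrable f P) (hexp : Integrable (fun x => Real.exp (f x)) Q)
    (h1 : ∫ x, Real.exp (f x) ∂Q ≤ 1) :
    ENNReal.ofReal (∫ x, f x ∂P) ≤ InformationTheory.klDiv P Q := by
  by_cases htop : InformationTheory.klDiv P Q = ∞
  · simp [htop]
  obtain ⟨hac, hint⟩ := InformationTheory.klDiv_ne_top_iff.1 htop
  have := isProbabilityMeasure_tilted hexp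
  -- The bound is the nonnegativity of the divergence of `P` from `Q.tilted f`, which equals KL(P‖Q)
  -- - ∫ f dP + log ∫ exp f dQ.
  have h := InformationTheory.integral_llr_add_sub_measure_univ_nonneg
    (hac.trans (absolutelyContinuous_tilted hexp)) (integrable_llr_tilted_right hac hf hint hexp)
  rw [integral_llr_tilted_right hac hf hexp hint] at h
  rw [InformationTheory.klDiv_of_ac_of_integrable hac hint]
  have hlog := Real.log_nonpos (integral_nonneg fun x => (Real.exp_pos (f x)).le) h1
  simp only [probReal_univ] at h ⊢
  exact ENNReal.ofReal_le_ofReal (by linarith)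

/-- The equality case of the Donsker-Varadhan bound. -/
theorem eq_tilted_of_klDiv_le [IsProbabilityMeasure P] [IsProbabilityMeasure Q] {c : ℝ}
    (hf : Integrable f P) (hexp : Integrable (fun x => Real.exp (f x)) Q)
    (h1 : ∫ x, Real.exp (f x) ∂Q ≤ 1) (hc0 : 0 ≤ c) (hc : c ≤ ∫ x, f x ∂P)
    (hkl : InformationTheory.klDiv P Q ≤ ENNReal.ofReal c) :
    P = Q.tilted f ∧ ∫ x, Real.exp (f x) ∂Q = 1 := by
  obtain ⟨hac, hint⟩ := InformationTheory.klDiv_ne_top_iff.1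
    (hkl.trans_lt ENNReal.ofReal_lt_top).ne
  have := isProbabilityMeasure_tilted hexp
  have hac' := hac.trans (absolutelyContinuous_tilted hexp)
  have hint' := integrable_llr_tilted_right hac hf hint hexp
  have h := InformationTheory.integral_llr_add_sub_measure_univ_nonneg hac' hint'
  rw [InformationTheory.klDiv_of_ac_of_integrable hac hint,
    ENNReal.ofReal_le_ofReal_iff hc0] at hkl
  have hpos : 0 < ∫ x, Real.exp (f x) ∂Q := integral_exp_pos hexp
  have hlog := Real.log_nonpos hpos.le h1
  rw [integral_llr_tilted_right hac hf hexp hint] at h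
  simp only [probReal_univ] at h hkl
  have hlog0 : Real.log (∫ x, Real.exp (f x) ∂Q) = 0 := by linarith
  refine ⟨InformationTheory.klDiv_eq_zero_iff.1 ?_, ?_⟩
  · rw [InformationTheory.klDiv_of_ac_of_integrable hac' hint',
      integral_llr_tilted_right hac hf hexp hint]
    simp only [probReal_univ, ENNReal.ofReal_eq_zero]
    linarith
  · exact Real.eq_one_of_pos_of_log_eq_zero hpos hlog0

/-- With normalising constant 1, the log-likelihood ratio is `f` itself. -/
theorem klDiv_tilted_self [IsProbabilityMeasure Q] (hf : Integrable f (Q.tilted f))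
    (hfm : AEMeasurable f Q)
    (hexp : Integrable (fun x => Real.exp (f x)) Q) (h1 : ∫ x, Real.exp (f x) ∂Q = 1) :
    InformationTheory.klDiv (Q.tilted f) Q = ENNReal.ofReal (∫ x, f x ∂Q.tilted f) := by
  have := isProbabilityMeasure_tilted hexp
  have hac : Q.tilted f ≪ Q := tilted_absolutelyContinuous Q f
  have hllr : llr (Q.tilted f) Q =ᵐ[Q.tilted f] f := by
    refine hac.ae_le ?_
    filter_upwards [llr_tilted_left Measure.AbsolutelyContinuous.rfl hexp hfm, llr_self Q]
      with x hx hx'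
    rw [hx, hx', h1]
    simp
  rw [InformationTheory.klDiv_of_ac_of_integrable hac ((integrable_congr hllr).2 hf),
    integral_congr_ae hllr]
  simp

end Gibbs

/-! ### One-dimensional Gaussian integral. -/

section Real

/-- The Fourier transform of the one-dimensional Gaussian law `N(0, v)` weighted by the optimal
information density at reconstruction level `y`. -/
theorem integral_cexp_mul_weight_gaussianReal {v θ : ℝ} (hv : 0 ≤ v) (hθ : 0 < θ) (y t : ℝ) :
    ∫ x : ℝ, Complex.exp (x * t * Complex.I) *
        (Real.exp (Real.log (max v θ / θ) / 2 + x ^ 2 / (2 * max v θ) - (x - y) ^ 2 / (2 * θ)) : ℂ)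
        ∂gaussianReal 0 v.toNNReal =
      Complex.exp (t * (v / max v θ) * y * Complex.I - (θ * v / max v θ) * t ^ 2 / 2
        - y ^ 2 * (1 - v / max v θ) / (2 * θ) : ℂ) := by
  -- The maximum is a root of (m - v)(m - θ); this relation replaces a case split on the side of the
  -- water level.
  have hm : (max v θ - v) * (max v θ - θ) = 0 := by
    rcases le_total v θ with h | h <;> simp [h]
  have hm0 : 0 < max v θ := lt_max_of_lt_right hθ
  rcases hv.eq_or_lt with rfl | hv
  · simp only [Real.toNNReal_zero, gaussianReal_zero_var, integral_dirac]
    rw [max_eq_right hθ.le]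
    simp [hθ.ne']
  have hv' : v.toNNReal ≠ 0 := by simpa using hv
  rw [integral_gaussianReal_eq_integral_smul hv']
  set m := max v θ with hmdef
  have hmC : (m : ℂ) ^ 2 = m * (v + θ) - v * θ := by
    exact_mod_cast (by linear_combination hm : m ^ 2 = m * (v + θ) - v * θ)
  have hmC0 : (m : ℂ) ≠ 0 := by exact_mod_cast hm0.ne'
  have hvC0 : (v : ℂ) ≠ 0 := by exact_mod_cast hv.ne'
  have hθC0 : (θ : ℂ) ≠ 0 := by exact_mod_cast hθ.ne'
  set K : ℝ := (Real.sqrt (2 * Real.pi * v))⁻¹ * Real.sqrt (m / θ) with hK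
  have hsqrt : Real.exp (Real.log (m / θ) / 2) = Real.sqrt (m / θ) := by
    rw [Real.sqrt_eq_rpow, Real.rpow_def_of_pos (by positivity)]; ring_nf
  have hpt (x : ℝ) : gaussianPDFReal 0 v.toNNReal x • (Complex.exp (x * t * Complex.I) *
        (Real.exp (Real.log (m / θ) / 2 + x ^ 2 / (2 * m) - (x - y) ^ 2 / (2 * θ)) : ℂ)) =
      K * Complex.exp ((-(m / (2 * θ * v)) : ℂ) * x ^ 2 + (y / θ + t * Complex.I) * x
        + (-(y ^ 2 / (2 * θ)))) := by
    rw [gaussianPDFReal, Real.coe_toNNReal _ hv.le, add_sub_assoc, Real.exp_add, hsqrt, hK,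
      Complex.real_smul]
    push_cast
    rw [show ∀ a b c d e : ℂ, a * b * (c * (d * e)) = a * d * (b * c * e) by intros; ring,
      ← Complex.exp_add, ← Complex.exp_add]
    congr 2
    field_simp
    linear_combination (x ^ 2 : ℂ) * hmC
  simp_rw [hpt]
  rw [integral_const_mul, integral_cexp_quadratic]
  · have hbase : (Real.pi / -(-(m / (2 * θ * v))) : ℂ) = ((2 * Real.pi * θ * v / m : ℝ) : ℂ) := by
      push_cast; field_simp
    rw [hbase, show (1 / 2 : ℂ) = ((1 / 2 : ℝ) : ℂ) by norm_num,
      ← Complex.ofReal_cpow (by positivity), ← Real.sqrt_eq_rpow, ← mul_assoc, ← Complex.ofReal_mul]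
    have hone : K * Real.sqrt (2 * Real.pi * θ * v / m) = 1 := by
      rw [hK, mul_assoc, ← Real.sqrt_mul (by positivity), ← Real.sqrt_inv,
        ← Real.sqrt_mul (by positivity)]
      rw [show (2 * Real.pi * v)⁻¹ * (m / θ * (2 * Real.pi * θ * v / m)) = 1 by field_simp]
      simp
    rw [hone, Complex.ofReal_one, one_mul]
    congr 1
    field_simp
    ring_nf
    simp only [Complex.I_sq]
    ring
  · have : (-(m / (2 * θ * v)) : ℂ) = ((-(m / (2 * θ * v)) : ℝ) : ℂ) := by push_cast; rfl
    rw [this, Complex.ofReal_re]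
    have : 0 < m / (2 * θ * v) := by positivity
    linarith

end Real
-- Gaussian laws with diagonal covariance.
section Diagonal

variable {ι : Type*} [Fintype ι] [DecidableEq ι]

theorem charFun_multivariateGaussian_diagonal (m : EuclideanSpace ℝ ι) {v : ι → ℝ}
    (hv : ∀ j, 0 ≤ v j) (t : EuclideanSpace ℝ ι) :
    charFun (multivariateGaussian m (Matrix.diagonal v)) t =
      Complex.exp (∑ j, (t j * m j * Complex.I - v j * t j ^ 2 / 2)) := by
  rw [charFun_multivariateGaussian (Matrix.PosSemidef.diagonal hv)]
  congr 1
  simp only [PiLp.inner_apply, dotProduct, Matrix.mulVec_diagonal, Finset.sum_sub_distrib]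
  push_cast
  simp only [Finset.sum_mul, Finset.sum_div]
  congr 1
  · exact Finset.sum_congr rfl fun j _ => by simp [mul_comm]
  · exact Finset.sum_congr rfl fun j _ => by ring

theorem multivariateGaussian_diagonal_eq_map_pi (m : EuclideanSpace ℝ ι) {v : ι → ℝ}
    (hv : ∀ j, 0 ≤ v j) :
    multivariateGaussian m (Matrix.diagonal v) =
      (Measure.pi fun j => gaussianReal (m j) (v j).toNNReal).map (WithLp.toLp 2) := by
  apply Measure.ext_of_charFun (E := EuclideanSpace ℝ ι)
  ext t
  rw [charFun_multivariateGaussian_diagonal m hv, charFun_pi, Complex.exp_sum]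
  refine Finset.prod_congr rfl fun j _ => ?_
  rw [charFun_gaussianReal, Real.coe_toNNReal _ (hv j)]

theorem lintegral_sq_sub_gaussianReal (a m : ℝ) {v : ℝ} (hv : 0 ≤ v) :
    ∫⁻ x, ENNReal.ofReal ((x - a) ^ 2) ∂gaussianReal m v.toNNReal =
      ENNReal.ofReal (v + (m - a) ^ 2) := by
  have hL : MemLp (fun x : ℝ => x - a) 2 (gaussianReal m v.toNNReal) :=
    (memLp_id_gaussianReal 2).sub (memLp_const a)
  rw [← ofReal_integral_eq_lintegral_ofReal hL.integrable_sq (ae_of_all _ fun x => sq_nonneg _)]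
  congr 1
  have h := variance_eq_sub hL
  have hint : Integrable (fun x : ℝ => x) (gaussianReal m v.toNNReal) :=
    (memLp_id_gaussianReal 1).integrable le_rfl
  have hvar : Var[fun x : ℝ => x - a; gaussianReal m v.toNNReal] = v := by
    rw [variance_sub_const hint.aestronglyMeasurable, variance_fun_id_gaussianReal,
      Real.coe_toNNReal _ hv]
  rw [hvar, integral_sub hint (integrable_const a)] at h
  simp only [integral_id_gaussianReal, integral_const, probReal_univ, one_smul] at h
  simp only [Pi.pow_apply] at h
  linarith

theorem map_eval_multivariateGaussian_diagonal (m : EuclideanSpace ℝ ι) {v : ι → ℝ}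
    (hv : ∀ j, 0 ≤ v j) (j : ι) :
    (multivariateGaussian m (Matrix.diagonal v)).map (fun x => x j) =
      gaussianReal (m j) (v j).toNNReal := by
  simpa using (measurePreserving_eval_multivariateGaussian (μ := m)
    (Matrix.PosSemidef.diagonal hv) (i := j)).map_eq

theorem lintegral_sq_sub_multivariateGaussian_diagonal (m : EuclideanSpace ℝ ι) {v : ι → ℝ}
    (hv : ∀ j, 0 ≤ v j) (j : ι) (a : ℝ) :
    ∫⁻ x, ENNReal.ofReal ((x j - a) ^ 2) ∂multivariateGaussian m (Matrix.diagonal v) =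
      ENNReal.ofReal (v j + (m j - a) ^ 2) := by
  rw [← lintegral_sq_sub_gaussianReal a (m j) (hv j),
    ← map_eval_multivariateGaussian_diagonal m hv j, lintegral_map (by fun_prop) (by fun_prop)]

end Diagonal

/-! ### Exponential moments of the information density. -/

section Density

variable {n : ℕ} {l : Fin n → ℝ} {θ : ℝ}

/-- The information density of the reverse water-filling test channel. -/
noncomputable def infoDensity (l : Fin n → ℝ) (θ : ℝ)
    (p : EuclideanSpace ℝ (Fin n) × EuclideanSpace ℝ (Fin n)) : ℝ :=
  ∑ j, (Real.log (max (l j) θ / θ) / 2 + p.1 j ^ 2 / (2 * max (l j) θ)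
    - (p.1 j - p.2 j) ^ 2 / (2 * θ))

theorem measurable_infoDensity (l : Fin n → ℝ) (θ : ℝ) : Measurable (infoDensity l θ) := by
  unfold infoDensity
  fun_prop

instance (l : Fin n → ℝ) : IsProbabilityMeasure (gaussianSource l) := by
  unfold gaussianSource
  infer_instance

theorem integral_cexp_inner_mul_exp_infoDensity (hl : ∀ j, 0 ≤ l j) (hθ : 0 < θ)
    (y t : EuclideanSpace ℝ (Fin n)) :
    ∫ x, Complex.exp (inner ℝ x t * Complex.I) * (Real.exp (infoDensity l θ (x, y)) : ℂ)
        ∂gaussianSource l =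
      Complex.exp (∑ j, (t j * (l j / max (l j) θ : ℝ) * y j * Complex.I
        - (θ * l j / max (l j) θ : ℝ) * t j ^ 2 / 2
        - y j ^ 2 * (1 - l j / max (l j) θ : ℝ) / (2 * θ))) := by
  rw [gaussianSource, multivariateGaussian_diagonal_eq_map_pi _ hl,
    integral_map (by fun_prop)]
  · rw [Complex.exp_sum]
    have h := integral_fintype_prod_eq_prod (𝕜 := ℂ)
      (μ := fun j => gaussianReal 0 (l j).toNNReal)
      (E := fun _ => ℝ)
      (fun j (x : ℝ) => Complex.exp (x * t j * Complex.I) *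
        (Real.exp (Real.log (max (l j) θ / θ) / 2 + x ^ 2 / (2 * max (l j) θ)
          - (x - y j) ^ 2 / (2 * θ)) : ℂ))
    simp only [integral_cexp_mul_weight_gaussianReal (hl _) hθ] at h
    refine (integral_congr_ae (ae_of_all _ fun x => ?_)).trans
      (h.trans (Finset.prod_congr rfl fun j _ => ?_))
    · rw [Finset.prod_mul_distrib, ← Complex.exp_sum, infoDensity, Real.exp_sum,
        Complex.ofReal_prod]
      congr 2
      rw [PiLp.inner_apply, Complex.ofReal_sum, Finset.sum_mul]
      exact Finset.sum_congr rfl fun j _ => by simp [mul_comm]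
    · push_cast
      rfl
  · have := measurable_infoDensity l θ
    exact Measurable.aestronglyMeasurable (by fun_prop)

theorem integral_exp_infoDensity (hl : ∀ j, 0 ≤ l j) (hθ : 0 < θ)
    (y : EuclideanSpace ℝ (Fin n)) :
    ∫ x, Real.exp (infoDensity l θ (x, y)) ∂gaussianSource l =
      Real.exp (-∑ j, y j ^ 2 * (1 - l j / max (l j) θ) / (2 * θ)) := by
  have h := integral_cexp_inner_mul_exp_infoDensity hl hθ y 0
  simp only [inner_zero_right, Complex.ofReal_zero, zero_mul, Complex.exp_zero, one_mul,
    integral_complex_ofReal] at h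
  apply Complex.ofReal_injective
  rw [h]
  push_cast
  congr 1
  simp [Finset.sum_neg_distrib]

theorem integrable_exp_infoDensity_left (hl : ∀ j, 0 ≤ l j) (hθ : 0 < θ)
    (y : EuclideanSpace ℝ (Fin n)) :
    Integrable (fun x => Real.exp (infoDensity l θ (x, y))) (gaussianSource l) := by
  -- A non-integrable function has Bochner integral 0, contradicting the positive closed form.
  by_contra h
  have := integral_exp_infoDensity hl hθ y
  rw [integral_undef h] at this
  exact (Real.exp_pos _).ne this

theorem one_sub_div_max_nonneg (hl : ∀ j, 0 ≤ l j) (j : Fin n) :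
    0 ≤ 1 - l j / max (l j) θ :=
  sub_nonneg.2 (div_le_one_of_le₀ (le_max_left _ _) ((hl j).trans (le_max_left _ _)))

theorem integral_exp_infoDensity_le_one (hl : ∀ j, 0 ≤ l j) (hθ : 0 < θ)
    (y : EuclideanSpace ℝ (Fin n)) :
    ∫ x, Real.exp (infoDensity l θ (x, y)) ∂gaussianSource l ≤ 1 := by
  rw [integral_exp_infoDensity hl hθ, Real.exp_le_one_iff, neg_nonpos]
  exact Finset.sum_nonneg fun j _ => div_nonneg
    (mul_nonneg (sq_nonneg _) (one_sub_div_max_nonneg hl j)) (by positivity)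

variable {ν : Measure (EuclideanSpace ℝ (Fin n))} [IsProbabilityMeasure ν]

theorem integrable_integral_exp_infoDensity (hl : ∀ j, 0 ≤ l j) (hθ : 0 < θ) :
    Integrable (fun y => ∫ x, Real.exp (infoDensity l θ (x, y)) ∂gaussianSource l) ν := by
  refine Integrable.of_bound (C := 1) ?_ (ae_of_all _ fun y => ?_)
  · simp only [integral_exp_infoDensity hl hθ]
    exact Measurable.aestronglyMeasurable (by fun_prop)
  · rw [Real.norm_of_nonneg (integral_nonneg fun x => (Real.exp_pos _).le)]
    exact integral_exp_infoDensity_le_one hl hθ y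

theorem integrable_exp_infoDensity (hl : ∀ j, 0 ≤ l j) (hθ : 0 < θ) :
    Integrable (fun p => Real.exp (infoDensity l θ p)) ((gaussianSource l).prod ν) := by
  rw [integrable_prod_iff' (measurable_infoDensity l θ).exp.aestronglyMeasurable]
  refine ⟨ae_of_all _ fun y => integrable_exp_infoDensity_left hl hθ y, ?_⟩
  simpa using integrable_integral_exp_infoDensity (ν := ν) hl hθ

theorem integral_exp_infoDensity_prod (hl : ∀ j, 0 ≤ l j) (hθ : 0 < θ) :
    ∫ p, Real.exp (infoDensity l θ p) ∂(gaussianSource l).prod ν =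
      ∫ y, ∫ x, Real.exp (infoDensity l θ (x, y)) ∂gaussianSource l ∂ν :=
  integral_prod_symm _ (integrable_exp_infoDensity hl hθ)

/-- The bound already holds for each fixed `y`, so `ν` is arbitrary: one density serves against all
mappings. -/
theorem integral_exp_infoDensity_prod_le_one (hl : ∀ j, 0 ≤ l j) (hθ : 0 < θ) :
    ∫ p, Real.exp (infoDensity l θ p) ∂(gaussianSource l).prod ν ≤ 1 := by
  rw [integral_exp_infoDensity_prod hl hθ]
  refine (integral_mono (integrable_integral_exp_infoDensity hl hθ) (integrable_const 1)
    fun y => integral_exp_infoDensity_le_one hl hθ y).trans ?_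
  simp

/-- The weights integrate to one exactly when the reconstruction vanishes along the components
whose variance is below the water level. -/
theorem integral_exp_infoDensity_prod_eq_one_iff (hl : ∀ j, 0 ≤ l j) (hθ : 0 < θ) :
    ∫ p, Real.exp (infoDensity l θ p) ∂(gaussianSource l).prod ν = 1 ↔
      ∀ᵐ y ∂ν, ∀ j, y j * (1 - l j / max (l j) θ) = 0 := by
  have hI := integrable_integral_exp_infoDensity (ν := ν) hl hθ
  have h1 : ∫ p, Real.exp (infoDensity l θ p) ∂(gaussianSource l).prod ν = 1 ↔
      ∫ y, (1 - ∫ x, Real.exp (infoDensity l θ (x, y)) ∂gaussianSource l) ∂ν = 0 := by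
    rw [integral_exp_infoDensity_prod hl hθ, integral_sub (integrable_const _) hI]
    simp only [integral_const, probReal_univ, smul_eq_mul, mul_one, sub_eq_zero]
    exact eq_comm
  rw [h1, integral_eq_zero_iff_of_nonneg
    (fun y => sub_nonneg.2 (integral_exp_infoDensity_le_one hl hθ y))
    ((integrable_const _).sub hI)]
  refine Filter.eventually_congr (ae_of_all _ fun y => ?_)
  simp only [Pi.zero_apply, sub_eq_zero]
  rw [integral_exp_infoDensity hl hθ, eq_comm, Real.exp_eq_one_iff, neg_eq_zero,
    Finset.sum_eq_zero_iff_of_nonneg fun j _ => div_nonneg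
      (mul_nonneg (sq_nonneg _) (one_sub_div_max_nonneg hl j)) (by positivity)]
  simp [hθ.ne']

/-- The factorisation expresses the backward channel: x is x̂ plus independent Gaussian noise, so x̂
sees the frequency `s + t` and the noise sees `t`. -/
theorem integral_cexp_tilted_infoDensity (hl : ∀ j, 0 ≤ l j) (hθ : 0 < θ)
    (hν : ∀ᵐ y ∂ν, ∀ j, y j * (1 - l j / max (l j) θ) = 0)
    (t s : EuclideanSpace ℝ (Fin n)) :
    ∫ p, Complex.exp ((inner ℝ p.1 t + inner ℝ p.2 s : ℝ) * Complex.I)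
        ∂((gaussianSource l).prod ν).tilted (infoDensity l θ) =
      charFun ν (s + t) * Complex.exp (∑ j, -((θ * l j / max (l j) θ : ℝ) * t j ^ 2 / 2 : ℂ)) := by
  have hexp := integrable_exp_infoDensity (ν := ν) hl hθ
  have hm := measurable_infoDensity l θ
  rw [integral_tilted, (integral_exp_infoDensity_prod_eq_one_iff hl hθ).2 hν, integral_prod_symm,
    charFun_apply, ← integral_mul_const]
  · refine integral_congr_ae (hν.mono fun y hy => ?_)
    have h := integral_cexp_inner_mul_exp_infoDensity hl hθ y t
    calc _ = ∫ x, Complex.exp (inner ℝ y s * Complex.I) * (Complex.exp (inner ℝ x t * Complex.I)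
          * (Real.exp (infoDensity l θ (x, y)) : ℂ)) ∂gaussianSource l := by
          refine integral_congr_ae (ae_of_all _ fun x => ?_)
          simp only [div_one, Complex.real_smul]
          push_cast
          rw [add_mul, Complex.exp_add]
          ring
      _ = _ := by
          rw [integral_const_mul, h, ← Complex.exp_add]
          beta_reduce
          rw [← Complex.exp_add, inner_add_right]
          congr 1
          push_cast
          rw [add_mul, add_assoc]
          congr 1
          rw [PiLp.inner_apply, Complex.ofReal_sum, Finset.sum_mul, ← Finset.sum_add_distrib]
          refine Finset.sum_congr rfl fun j _ => ?_
          -- The support condition removes the shrinkage factor on `y j` in the phase and kills the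
          -- quadratic term in `y j`.
          have hyC : (y j : ℂ) * (1 - l j / max (l j) θ : ℝ) = 0 := by exact_mod_cast hy j
          push_cast at hyC
          simp only [RCLike.inner_apply, conj_trivial, Complex.ofReal_mul]
          linear_combination (-(t j * Complex.I) - y j / (2 * θ)) * hyC
  · refine hexp.mono (Measurable.aestronglyMeasurable (by fun_prop)) (ae_of_all _ fun p => ?_)
    rw [div_one, norm_smul, Complex.norm_exp_ofReal_mul_I, mul_one]

end Density
variable {n : ℕ} {l : Fin n → ℝ} {θ : ℝ}

/-! ### Algebra of the water-filling coefficients. -/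

section Coefficients

theorem variance_mul_tau (hl : ∀ j, 0 ≤ l j) (hθ : 0 ≤ θ) (j : Fin n) :
    l j * tau l θ j = min θ (l j) := by
  unfold tau
  split_ifs with h
  · simp [h, hθ]
  · rw [mul_min_of_nonneg _ _ (hl j), mul_one, mul_div_cancel₀ _ h, min_comm]

theorem tau_nonneg (hl : ∀ j, 0 ≤ l j) (hθ : 0 ≤ θ) (j : Fin n) : 0 ≤ tau l θ j := by
  unfold tau
  split_ifs
  · exact zero_le_one
  · exact le_min zero_le_one (div_nonneg hθ (hl j))

theorem tau_le_one (j : Fin n) : tau l θ j ≤ 1 := by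
  unfold tau
  split_ifs
  · exact le_rfl
  · exact min_le_left _ _

theorem matS_eq_diagonal : matS l θ = Matrix.diagonal fun j => 1 - tau l θ j := by
  rw [matS, matT, ← Matrix.diagonal_one, Matrix.diagonal_sub]

theorem diagonal_mul_matS (hl : ∀ j, 0 ≤ l j) (hθ : 0 ≤ θ) :
    Matrix.diagonal l * matS l θ = Matrix.diagonal fun j => l j - min θ (l j) := by
  rw [matS_eq_diagonal, Matrix.diagonal_mul_diagonal]
  congr 1
  ext j
  rw [mul_sub, mul_one, variance_mul_tau hl hθ]

theorem gaussianEncoder_apply (β : EuclideanSpace ℝ (Fin n)) :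
    gaussianEncoder l θ β = multivariateGaussian (WithLp.toLp 2 fun j => (1 - tau l θ j) * β j)
      (Matrix.diagonal fun j => l j * (1 - tau l θ j) * tau l θ j) := by
  change multivariateGaussian _ _ = _
  rw [matS_eq_diagonal, matT, Matrix.diagonal_mul_diagonal, Matrix.diagonal_mul_diagonal]
  congr 2
  ext j
  rw [Matrix.mulVec_diagonal]

theorem encoder_variance_nonneg (hl : ∀ j, 0 ≤ l j) (hθ : 0 ≤ θ) (j : Fin n) :
    0 ≤ l j * (1 - tau l θ j) * tau l θ j :=
  mul_nonneg (mul_nonneg (hl j) (sub_nonneg.2 (tau_le_one j))) (tau_nonneg hl hθ j)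

/-- Links the maxima in the density to the minima in the distortion. -/
theorem mul_div_max_eq_min (hθ : 0 < θ) (j : Fin n) : θ * l j / max (l j) θ = min θ (l j) := by
  have h : max (l j) θ ≠ 0 := (lt_max_of_lt_right hθ).ne'
  rw [div_eq_iff h, mul_comm θ, min_comm, min_mul_max]

theorem sub_min_nonneg (j : Fin n) : 0 ≤ l j - min θ (l j) := sub_nonneg.2 (min_le_right _ _)

end Coefficients

instance : IsMarkovKernel (gaussianEncoder l θ) :=
  ⟨fun β => by rw [gaussianEncoder_apply]; infer_instance⟩

/-! ### Joint laws identified by characteristic functions. -/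

section CharFun

/-- By Riesz representation on each factor, a continuous functional on `E × E` is a sum of two inner
products; the product itself carries no inner product structure. -/
theorem ext_of_integral_cexp_inner {E : Type*} [NormedAddCommGroup E] [InnerProductSpace ℝ E]
    [CompleteSpace E] [SecondCountableTopology E] [MeasurableSpace E] [BorelSpace E]
    {P P' : Measure (E × E)} [IsFiniteMeasure P] [IsFiniteMeasure P']
    (h : ∀ t s : E, ∫ p, Complex.exp ((inner ℝ p.1 t + inner ℝ p.2 s : ℝ) * Complex.I) ∂P =
      ∫ p, Complex.exp ((inner ℝ p.1 t + inner ℝ p.2 s : ℝ) * Complex.I) ∂P') : P = P' := by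
  apply Measure.ext_of_charFunDual
  ext L
  have hL (p : E × E) : L p =
      inner ℝ p.1 ((InnerProductSpace.toDual ℝ E).symm (L.comp (.inl ℝ E E))) +
      inner ℝ p.2 ((InnerProductSpace.toDual ℝ E).symm (L.comp (.inr ℝ E E))) := by
    rw [real_inner_comm, real_inner_comm _ p.2, InnerProductSpace.toDual_symm_apply,
      InnerProductSpace.toDual_symm_apply]
    simp [← map_add]
  simp only [charFunDual_apply, hL]
  exact h _ _

theorem charFun_gaussianSource (hl : ∀ j, 0 ≤ l j) (t : EuclideanSpace ℝ (Fin n)) :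
    charFun (gaussianSource l) t = Complex.exp (∑ j, -(l j * t j ^ 2 / 2 : ℂ)) := by
  rw [gaussianSource, charFun_multivariateGaussian_diagonal _ hl]
  simp

theorem charFun_gaussianEncoder (hl : ∀ j, 0 ≤ l j) (hθ : 0 ≤ θ)
    (β s : EuclideanSpace ℝ (Fin n)) :
    charFun (gaussianEncoder l θ β) s =
      Complex.exp (∑ j, -((l j * (1 - tau l θ j) * tau l θ j : ℝ) * s j ^ 2 / 2 : ℂ)) *
      Complex.exp (inner ℝ β (WithLp.toLp 2 fun j => (1 - tau l θ j) * s j) * Complex.I) := by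
  rw [gaussianEncoder_apply, charFun_multivariateGaussian_diagonal _
    (encoder_variance_nonneg hl hθ), ← Complex.exp_add, PiLp.inner_apply, Complex.ofReal_sum,
    Finset.sum_mul, ← Finset.sum_add_distrib]
  congr 1
  refine Finset.sum_congr rfl fun j _ => ?_
  simp only [RCLike.inner_apply, conj_trivial]
  push_cast
  ring

/-- The joint characteristic function of the source and the Gaussian reconstruction. -/
theorem integral_cexp_compProd_gaussianEncoder (hl : ∀ j, 0 ≤ l j) (hθ : 0 ≤ θ)
    (t s : EuclideanSpace ℝ (Fin n)) :
    ∫ p, Complex.exp ((inner ℝ p.1 t + inner ℝ p.2 s : ℝ) * Complex.I)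
        ∂(gaussianSource l ⊗ₘ gaussianEncoder l θ) =
      Complex.exp (∑ j, -((l j - min θ (l j) : ℝ) * (s j + t j) ^ 2 / 2
        + (min θ (l j) : ℝ) * t j ^ 2 / 2 : ℂ)) := by
  rw [Measure.integral_compProd]
  · have hinner (x : EuclideanSpace ℝ (Fin n)) :
        ∫ y, Complex.exp ((inner ℝ x t + inner ℝ y s : ℝ) * Complex.I) ∂gaussianEncoder l θ x =
          Complex.exp (∑ j, -((l j * (1 - tau l θ j) * tau l θ j : ℝ) * s j ^ 2 / 2 : ℂ)) *
          Complex.exp (inner ℝ x (t + WithLp.toLp 2 fun j => (1 - tau l θ j) * s j)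
            * Complex.I) := by
      have h (y : EuclideanSpace ℝ (Fin n)) :
          Complex.exp ((inner ℝ x t + inner ℝ y s : ℝ) * Complex.I) =
          Complex.exp (inner ℝ x t * Complex.I) * Complex.exp (inner ℝ y s * Complex.I) := by
        rw [← Complex.exp_add]; push_cast; ring_nf
      simp only [h]
      rw [integral_const_mul, ← charFun_apply, charFun_gaussianEncoder hl hθ, inner_add_right]
      push_cast
      rw [add_mul, Complex.exp_add]
      ring
    simp only [hinner]
    rw [integral_const_mul, ← charFun_apply, charFun_gaussianSource hl, ← Complex.exp_add,
      ← Finset.sum_add_distrib]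
    congr 1
    refine Finset.sum_congr rfl fun j _ => ?_
    rw [← variance_mul_tau hl hθ]
    simp only [PiLp.add_apply]
    push_cast
    ring
  · refine (integrable_const (1 : ℝ)).mono (Measurable.aestronglyMeasurable (by fun_prop))
      (ae_of_all _ fun p => ?_)
    rw [Complex.norm_exp_ofReal_mul_I]
    simp

theorem charFun_comp {κ : Kernel (EuclideanSpace ℝ (Fin n)) (EuclideanSpace ℝ (Fin n))}
    [IsMarkovKernel κ] {μ : Measure (EuclideanSpace ℝ (Fin n))} [SFinite μ]
    (s : EuclideanSpace ℝ (Fin n)) :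
    charFun (κ ∘ₘ μ) s =
      ∫ p, Complex.exp ((inner ℝ p.1 0 + inner ℝ p.2 s : ℝ) * Complex.I) ∂(μ ⊗ₘ κ) := by
  rw [← Measure.snd_compProd, charFun_apply, Measure.snd, integral_map (by fun_prop)
    (Measurable.aestronglyMeasurable (by fun_prop))]
  simp

theorem charFun_source {κ : Kernel (EuclideanSpace ℝ (Fin n)) (EuclideanSpace ℝ (Fin n))}
    [IsMarkovKernel κ] {μ : Measure (EuclideanSpace ℝ (Fin n))} [SFinite μ]
    (t : EuclideanSpace ℝ (Fin n)) :
    charFun μ t =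
      ∫ p, Complex.exp ((inner ℝ p.1 t + inner ℝ p.2 0 : ℝ) * Complex.I) ∂(μ ⊗ₘ κ) := by
  conv_lhs => rw [← Measure.fst_compProd μ κ]
  rw [charFun_apply, Measure.fst, integral_map (by fun_prop)
    (Measurable.aestronglyMeasurable (by fun_prop))]
  simp

theorem charFun_reconstruction (hl : ∀ j, 0 ≤ l j) (hθ : 0 ≤ θ)
    (t : EuclideanSpace ℝ (Fin n)) :
    charFun (multivariateGaussian 0 (Matrix.diagonal l * matS l θ)) t =
      Complex.exp (∑ j, -((l j - min θ (l j) : ℝ) * t j ^ 2 / 2 : ℂ)) := by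
  rw [diagonal_mul_matS hl hθ, charFun_multivariateGaussian_diagonal _ (fun j => sub_min_nonneg j)]
  simp

theorem comp_gaussianEncoder (hl : ∀ j, 0 ≤ l j) (hθ : 0 ≤ θ) :
    gaussianEncoder l θ ∘ₘ gaussianSource l =
      multivariateGaussian 0 (Matrix.diagonal l * matS l θ) := by
  apply Measure.ext_of_charFun
  ext s
  rw [charFun_comp, integral_cexp_compProd_gaussianEncoder hl hθ, charFun_reconstruction hl hθ]
  simp

theorem ae_reconstruction_mul_eq_zero (hl : ∀ j, 0 ≤ l j) (hθ : 0 < θ) :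
    ∀ᵐ y ∂multivariateGaussian 0 (Matrix.diagonal l * matS l θ),
      ∀ j, y j * (1 - l j / max (l j) θ) = 0 := by
  rw [ae_all_iff]
  intro j
  rcases le_total θ (l j) with h | h
  · have : l j ≠ 0 := (hθ.trans_le h).ne'
    simp [max_eq_left h, div_self this]
  -- At or below the water level, the reconstructed coordinate has variance 0, so its law is a Dirac
  -- mass.
  · have hmap := map_eval_multivariateGaussian_diagonal (0 : EuclideanSpace ℝ (Fin n))
      (v := fun j => l j - min θ (l j)) (fun j => sub_min_nonneg j) j
    rw [diagonal_mul_matS hl hθ.le]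
    simp only [min_eq_right h, sub_self, Real.toNNReal_zero, gaussianReal_zero_var] at hmap
    have h0 : ∀ᵐ x ∂Measure.dirac (0 : ℝ), x = 0 := by simp [ae_dirac_eq]
    have := ae_of_ae_map (μ := multivariateGaussian 0 (Matrix.diagonal fun j => l j - min θ (l j)))
      (f := fun x : EuclideanSpace ℝ (Fin n) => x j) (by fun_prop) (p := fun x => x = 0)
      (by rw [hmap]; exact h0)
    filter_upwards [this] with y hy
    simp [hy]

/-- The joint law of the Gaussian test channel is an exponential tilting of the product of its
marginal laws. -/
theorem compProd_gaussianEncoder_eq_tilted (hl : ∀ j, 0 ≤ l j) (hθ : 0 < θ) :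
    gaussianSource l ⊗ₘ gaussianEncoder l θ =
      ((gaussianSource l).prod (multivariateGaussian 0 (Matrix.diagonal l * matS l θ))).tilted
        (infoDensity l θ) := by
  have := isProbabilityMeasure_tilted (integrable_exp_infoDensity
    (ν := multivariateGaussian 0 (Matrix.diagonal l * matS l θ)) hl hθ)
  refine ext_of_integral_cexp_inner fun t s => ?_
  rw [integral_cexp_compProd_gaussianEncoder hl hθ.le,
    integral_cexp_tilted_infoDensity hl hθ (ae_reconstruction_mul_eq_zero hl hθ),
    charFun_reconstruction hl hθ.le, ← Complex.exp_add, ← Finset.sum_add_distrib]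
  congr 1
  refine Finset.sum_congr rfl fun j _ => ?_
  rw [mul_div_max_eq_min hθ]
  simp only [PiLp.add_apply]
  push_cast
  ring

/-- A tilted joint law with source marginal `N(0, Σ)` has reconstruction law `N(0, Σ S_θ)`. -/
theorem comp_eq_of_compProd_eq_tilted (hl : ∀ j, 0 ≤ l j) (hθ : 0 < θ)
    {κ : Kernel (EuclideanSpace ℝ (Fin n)) (EuclideanSpace ℝ (Fin n))} [IsMarkovKernel κ]
    (hκ : gaussianSource l ⊗ₘ κ =
      ((gaussianSource l).prod (κ ∘ₘ gaussianSource l)).tilted (infoDensity l θ))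
    (h0 : ∀ᵐ y ∂(κ ∘ₘ gaussianSource l), ∀ j, y j * (1 - l j / max (l j) θ) = 0) :
    κ ∘ₘ gaussianSource l = multivariateGaussian 0 (Matrix.diagonal l * matS l θ) := by
  apply Measure.ext_of_charFun
  ext t
  have h := charFun_source (κ := κ) (μ := gaussianSource l) t
  rw [hκ, integral_cexp_tilted_infoDensity hl hθ h0, zero_add, charFun_gaussianSource hl] at h
  -- Deconvolution: the noise factor in `h` is an exponential, hence can be cancelled.
  rw [charFun_reconstruction hl hθ.le, ← mul_left_inj' (Complex.exp_ne_zero _), ← h,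
    ← Complex.exp_add, ← Finset.sum_add_distrib]
  congr 1
  refine Finset.sum_congr rfl fun j _ => ?_
  rw [mul_div_max_eq_min hθ]
  push_cast
  ring

end CharFun

/-! ### Distortion and the mean information density. -/

section Distortion

theorem distortion_gaussianEncoder (hl : ∀ j, 0 ≤ l j) (hθ : 0 ≤ θ) :
    distortion (gaussianSource l) (gaussianEncoder l θ) =
      ENNReal.ofReal (∑ j, min θ (l j)) := by
  have hsum (p : EuclideanSpace ℝ (Fin n) × EuclideanSpace ℝ (Fin n)) :
      ENNReal.ofReal (‖p.1 - p.2‖ ^ 2) = ∑ j, ENNReal.ofReal ((p.2 j - p.1 j) ^ 2) := by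
    rw [EuclideanSpace.norm_sq_eq, ENNReal.ofReal_sum_of_nonneg fun j _ => sq_nonneg _]
    refine Finset.sum_congr rfl fun j _ => ?_
    rw [PiLp.sub_apply, Real.norm_eq_abs, sq_abs, ← neg_sub, neg_sq]
  unfold distortion
  simp only [hsum]
  rw [lintegral_finsetSum _ fun _ _ => by fun_prop,
    ENNReal.ofReal_sum_of_nonneg fun j _ => le_min hθ (hl j)]
  refine Finset.sum_congr rfl fun j _ => ?_
  rw [Measure.lintegral_compProd (by fun_prop)]
  -- Conditional variance plus squared bias, the bias being -τ_j x_j; averaging over x gives λ_j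
  -- τ_j.
  have h1 (x : EuclideanSpace ℝ (Fin n)) :
      ∫⁻ y, ENNReal.ofReal ((y j - x j) ^ 2) ∂gaussianEncoder l θ x =
        ENNReal.ofReal (l j * (1 - tau l θ j) * tau l θ j) +
          ENNReal.ofReal (tau l θ j ^ 2) * ENNReal.ofReal ((x j - 0) ^ 2) := by
    rw [gaussianEncoder_apply, lintegral_sq_sub_multivariateGaussian_diagonal _
      (encoder_variance_nonneg hl hθ), ← ENNReal.ofReal_mul (sq_nonneg _),
      ← ENNReal.ofReal_add (encoder_variance_nonneg hl hθ j) (by positivity)]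
    congr 1
    ring
  simp only [h1]
  rw [lintegral_add_left (by fun_prop), lintegral_const_mul _ (by fun_prop), gaussianSource,
    lintegral_sq_sub_multivariateGaussian_diagonal _ hl]
  simp only [lintegral_const, measure_univ, mul_one, PiLp.zero_apply, sub_zero]
  rw [← ENNReal.ofReal_mul (sq_nonneg _), ← ENNReal.ofReal_add (encoder_variance_nonneg hl hθ j)
    (mul_nonneg (sq_nonneg _) (add_nonneg (hl j) (sq_nonneg _))), ← variance_mul_tau hl hθ]
  congr 1
  ring

/-- A mapping of zero distortion copies the source. -/
theorem compProd_eq_map_of_distortion_eq_zero {μ : Measure (EuclideanSpace ℝ (Fin n))}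
    [IsProbabilityMeasure μ]
    {κ : Kernel (EuclideanSpace ℝ (Fin n)) (EuclideanSpace ℝ (Fin n))} [IsMarkovKernel κ]
    (h : distortion μ κ = 0) : μ ⊗ₘ κ = μ.map fun x => (x, x) := by
  rw [distortion, lintegral_eq_zero_iff (by fun_prop)] at h
  have hae : (fun p : EuclideanSpace ℝ (Fin n) × EuclideanSpace ℝ (Fin n) => p)
      =ᵐ[μ ⊗ₘ κ] fun p => (p.1, p.1) := by
    filter_upwards [h] with p hp
    have h0 : ‖p.1 - p.2‖ ^ 2 = 0 :=
      le_antisymm (ENNReal.ofReal_eq_zero.1 hp) (sq_nonneg _)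
    have : p.1 = p.2 := sub_eq_zero.1 (norm_eq_zero.1 (pow_eq_zero_iff two_ne_zero |>.1 h0))
    exact Prod.ext rfl this.symm
  calc μ ⊗ₘ κ = (μ ⊗ₘ κ).map fun p => p := Measure.map_id.symm
    _ = (μ ⊗ₘ κ).map fun p => (p.1, p.1) := Measure.map_congr hae
    _ = ((μ ⊗ₘ κ).map Prod.fst).map fun x => (x, x) := by
        rw [Measure.map_map (by fun_prop) (by fun_prop)]; rfl
    _ = μ.map fun x => (x, x) := by rw [← Measure.fst, Measure.fst_compProd]

variable {κ : Kernel (EuclideanSpace ℝ (Fin n)) (EuclideanSpace ℝ (Fin n))}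

theorem integrable_norm_sq_of_distortion (hκ : distortion (gaussianSource l) κ ≠ ∞) :
    Integrable (fun p => ‖p.1 - p.2‖ ^ 2) (gaussianSource l ⊗ₘ κ) := by
  refine ⟨Measurable.aestronglyMeasurable (by fun_prop), ?_⟩
  rw [hasFiniteIntegral_iff_ofReal (ae_of_all _ fun p => sq_nonneg _)]
  exact hκ.lt_top

variable [IsMarkovKernel κ]

/-- The first marginal is the source whatever `κ` is, so these moments do not depend on the mapping.
-/
theorem integral_coord_sq (hl : ∀ j, 0 ≤ l j) (j : Fin n) :
    Integrable (fun p : EuclideanSpace ℝ (Fin n) × EuclideanSpace ℝ (Fin n) => p.1 j ^ 2)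
        (gaussianSource l ⊗ₘ κ) ∧
      ∫ p, p.1 j ^ 2 ∂(gaussianSource l ⊗ₘ κ) = l j := by
  have hlin : ∫⁻ p, ENNReal.ofReal (p.1 j ^ 2) ∂(gaussianSource l ⊗ₘ κ) =
      ENNReal.ofReal (l j) := by
    rw [Measure.lintegral_compProd (by fun_prop)]
    have := lintegral_sq_sub_multivariateGaussian_diagonal (0 : EuclideanSpace ℝ (Fin n)) hl j 0
    simpa [gaussianSource] using this
  constructor
  · refine ⟨Measurable.aestronglyMeasurable (by fun_prop), ?_⟩
    rw [hasFiniteIntegral_iff_ofReal (ae_of_all _ fun p => sq_nonneg _), hlin]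
    exact ENNReal.ofReal_lt_top
  · rw [integral_eq_lintegral_of_nonneg_ae (ae_of_all _ fun p => sq_nonneg _)
      (Measurable.aestronglyMeasurable (by fun_prop)), hlin, ENNReal.toReal_ofReal (hl j)]

/-- The rate `∑ ½ log (λ_j / min (θ, λ_j))` (in nats) of reverse water-filling. -/
noncomputable def waterFillingRate (l : Fin n → ℝ) (θ : ℝ) : ℝ :=
  ∑ j, Real.log (max (l j) θ / θ) / 2

theorem waterFillingRate_nonneg (hθ : 0 < θ) : 0 ≤ waterFillingRate l θ :=
  Finset.sum_nonneg fun _ _ => div_nonneg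
    (Real.log_nonneg ((one_le_div hθ).2 (le_max_right _ _))) zero_le_two

theorem infoDensity_eq (p : EuclideanSpace ℝ (Fin n) × EuclideanSpace ℝ (Fin n)) :
    infoDensity l θ p = waterFillingRate l θ + ∑ j, p.1 j ^ 2 / (2 * max (l j) θ)
      - ‖p.1 - p.2‖ ^ 2 / (2 * θ) := by
  rw [infoDensity, waterFillingRate, Finset.sum_sub_distrib, Finset.sum_add_distrib,
    EuclideanSpace.norm_sq_eq, Finset.sum_div]
  simp

theorem integrable_infoDensity (hl : ∀ j, 0 ≤ l j)
    (hκ : distortion (gaussianSource l) κ ≠ ∞) :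
    Integrable (infoDensity l θ) (gaussianSource l ⊗ₘ κ) := by
  simp only [funext (infoDensity_eq (l := l) (θ := θ))]
  exact ((integrable_const _).add (integrable_finsetSum _ fun j _ =>
    (integral_coord_sq hl j).1.div_const _)).sub
      ((integrable_norm_sq_of_distortion hκ).div_const _)

theorem integral_infoDensity (hl : ∀ j, 0 ≤ l j) (hθ : 0 < θ)
    (hκ : distortion (gaussianSource l) κ ≠ ∞) :
    ∫ p, infoDensity l θ p ∂(gaussianSource l ⊗ₘ κ) = waterFillingRate l θ +
      (∑ j, min θ (l j) - (distortion (gaussianSource l) κ).toReal) / (2 * θ) := by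
  have hi (j : Fin n) : Integrable (fun p : EuclideanSpace ℝ (Fin n) × EuclideanSpace ℝ (Fin n) =>
      p.1 j ^ 2 / (2 * max (l j) θ)) (gaussianSource l ⊗ₘ κ) :=
    (integral_coord_sq hl j).1.div_const _
  have hD : ∫ p, ‖p.1 - p.2‖ ^ 2 ∂(gaussianSource l ⊗ₘ κ) =
      (distortion (gaussianSource l) κ).toReal :=
    integral_eq_lintegral_of_nonneg_ae (ae_of_all _ fun p => sq_nonneg _)
      (Measurable.aestronglyMeasurable (by fun_prop))
  have hs := integrable_finsetSum Finset.univ fun j _ => hi j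
  have hs' : Integrable (fun p : EuclideanSpace ℝ (Fin n) × EuclideanSpace ℝ (Fin n) =>
      waterFillingRate l θ + ∑ j, p.1 j ^ 2 / (2 * max (l j) θ)) (gaussianSource l ⊗ₘ κ) :=
    (integrable_const _).add hs
  simp only [funext (infoDensity_eq (l := l) (θ := θ))]
  rw [integral_sub hs' ((integrable_norm_sq_of_distortion hκ).div_const _),
    integral_add (integrable_const _) hs, integral_finsetSum _ fun j _ => hi j, integral_div, hD]
  simp only [integral_div, (integral_coord_sq hl _).2, integral_const, probReal_univ, one_smul]
  rw [sub_div, add_sub_assoc, Finset.sum_div]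
  congr 2
  refine Finset.sum_congr rfl fun j _ => ?_
  have : max (l j) θ ≠ 0 := (lt_max_of_lt_right hθ).ne'
  rw [← mul_div_max_eq_min hθ]
  field_simp

end Distortion

/-! ### Water level, converse, attainment and uniqueness. -/

section Optimality

theorem existsUnique_isReverseWaterFilling [NeZero n] (hl : Antitone l) (hl0 : ∀ j, 0 ≤ l j)
    {δ : ℝ} (hδ : δ ∈ Set.Icc 0 (∑ j, l j)) : ∃! θ : ℝ, IsReverseWaterFilling l δ θ := by
  have hle (j : Fin n) : l j ≤ l 0 := hl (Fin.zero_le j)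
  have hmono : StrictMonoOn (fun θ => ∑ j, min θ (l j)) (Set.Icc 0 (l 0)) := by
    -- The largest variance provides strictness: on `[0, l 0]` its term is the water level itself.
    intro a ha b hb hab
    refine Finset.sum_lt_sum (fun j _ => min_le_min_right _ hab.le) ⟨0, Finset.mem_univ _, ?_⟩
    rwa [min_eq_left ha.2, min_eq_left hb.2]
  have hcont : Continuous fun θ : ℝ => ∑ j, min θ (l j) := by fun_prop
  have hδ' : δ ∈ Set.Icc (∑ j, min 0 (l j)) (∑ j, min (l 0) (l j)) := by
    simpa only [min_eq_left (hl0 _), min_eq_right (hle _), Finset.sum_const_zero] using hδ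
  obtain ⟨θ, hθ, hθδ⟩ := intermediate_value_Icc (hl0 0) hcont.continuousOn hδ'
  refine ⟨θ, ⟨hθ, hθδ.symm⟩, fun θ' hθ' => hmono.injOn hθ'.1 hθ ?_⟩
  exact hθ'.2.symm.trans hθδ.symm

variable {κ : Kernel (EuclideanSpace ℝ (Fin n)) (EuclideanSpace ℝ (Fin n))}

theorem waterFillingRate_le_integral [IsMarkovKernel κ] (hl : ∀ j, 0 ≤ l j) (hθ : 0 < θ)
    (hκ : distortion (gaussianSource l) κ ≤ ENNReal.ofReal (∑ j, min θ (l j))) :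
    waterFillingRate l θ ≤ ∫ p, infoDensity l θ p ∂(gaussianSource l ⊗ₘ κ) := by
  rw [integral_infoDensity hl hθ (hκ.trans_lt ENNReal.ofReal_lt_top).ne]
  have := ENNReal.toReal_le_of_le_ofReal
    (Finset.sum_nonneg fun j _ => le_min hθ.le (hl j)) hκ
  have : 0 ≤ (∑ j, min θ (l j) - (distortion (gaussianSource l) κ).toReal) / (2 * θ) :=
    div_nonneg (sub_nonneg.2 this) (by positivity)
  linarith

theorem waterFillingRate_le_mutualInfo [IsMarkovKernel κ] (hl : ∀ j, 0 ≤ l j) (hθ : 0 < θ)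
    (hκ : distortion (gaussianSource l) κ ≤ ENNReal.ofReal (∑ j, min θ (l j))) :
    ENNReal.ofReal (waterFillingRate l θ) / ENNReal.ofReal (Real.log 2) ≤
      mutualInfo (gaussianSource l) κ :=
  ENNReal.div_le_div_right ((ENNReal.ofReal_le_ofReal (waterFillingRate_le_integral hl hθ hκ)).trans
    (ofReal_integral_le_klDiv (integrable_infoDensity hl (hκ.trans_lt ENNReal.ofReal_lt_top).ne)
      (integrable_exp_infoDensity hl hθ) (integral_exp_infoDensity_prod_le_one hl hθ))) _

theorem mutualInfo_gaussianEncoder (hl : ∀ j, 0 ≤ l j) (hθ : 0 < θ) :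
    mutualInfo (gaussianSource l) (gaussianEncoder l θ) =
      ENNReal.ofReal (waterFillingRate l θ) / ENNReal.ofReal (Real.log 2) := by
  have hD := distortion_gaussianEncoder hl hθ.le
  have hDtop : distortion (gaussianSource l) (gaussianEncoder l θ) ≠ ∞ := by
    rw [hD]; exact ENNReal.ofReal_ne_top
  have hint := integrable_infoDensity (θ := θ) hl hDtop
  have hval := integral_infoDensity hl hθ hDtop
  rw [hD, ENNReal.toReal_ofReal (Finset.sum_nonneg fun j _ => le_min hθ.le (hl j)), sub_self,
    zero_div, add_zero] at hval
  rw [mutualInfo, comp_gaussianEncoder hl hθ.le, ← hval]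
  rw [compProd_gaussianEncoder_eq_tilted hl hθ] at hint ⊢
  rw [klDiv_tilted_self hint (measurable_infoDensity l θ).aemeasurable
    (integrable_exp_infoDensity hl hθ) ((integral_exp_infoDensity_prod_eq_one_iff hl hθ).2
      (ae_reconstruction_mul_eq_zero hl hθ))]

theorem rate_gaussianSource (hl : ∀ j, 0 ≤ l j) (hθ : 0 < θ) :
    rate (gaussianSource l) (∑ j, min θ (l j)) =
      ENNReal.ofReal (waterFillingRate l θ) / ENNReal.ofReal (Real.log 2) := by
  refine le_antisymm ?_ (le_iInf₂ fun κ _ => le_iInf fun hκ =>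
    waterFillingRate_le_mutualInfo hl hθ hκ)
  rw [← mutualInfo_gaussianEncoder hl hθ]
  exact iInf₂_le_of_le _ inferInstance (iInf_le _ (distortion_gaussianEncoder hl hθ.le).le)

theorem ae_eq_gaussianEncoder_of_compProd_eq [IsMarkovKernel κ]
    (h : gaussianSource l ⊗ₘ κ = gaussianSource l ⊗ₘ gaussianEncoder l θ) :
    ∀ᵐ β ∂gaussianSource l, κ β = gaussianEncoder l θ β :=
  Kernel.ae_eq_of_compProd_eq h

theorem compProd_eq_of_isOptimalEncoding (hl : ∀ j, 0 ≤ l j) (hθ : 0 < θ)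
    (hκ : IsOptimalEncoding (gaussianSource l) (∑ j, min θ (l j)) κ) :
    gaussianSource l ⊗ₘ κ = gaussianSource l ⊗ₘ gaussianEncoder l θ := by
  have := hκ.isMarkov
  have hmi := hκ.mutualInfo_eq
  have hlog : ENNReal.ofReal (Real.log 2) ≠ 0 := by
    simpa using Real.log_pos one_lt_two
  rw [rate_gaussianSource hl hθ, mutualInfo] at hmi
  -- Conversion from bits to nats.
  replace hmi := congrArg (· * ENNReal.ofReal (Real.log 2)) hmi
  simp only [ENNReal.div_mul_cancel hlog ENNReal.ofReal_ne_top] at hmi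
  obtain ⟨htilt, hone⟩ := eq_tilted_of_klDiv_le
    (integrable_infoDensity hl (hκ.distortion_le.trans_lt ENNReal.ofReal_lt_top).ne)
    (integrable_exp_infoDensity hl hθ) (integral_exp_infoDensity_prod_le_one hl hθ)
    (waterFillingRate_nonneg hθ) (waterFillingRate_le_integral hl hθ hκ.distortion_le) hmi.le
  have hν := comp_eq_of_compProd_eq_tilted hl hθ htilt
    ((integral_exp_infoDensity_prod_eq_one_iff hl hθ).1 hone)
  rw [compProd_gaussianEncoder_eq_tilted hl hθ, htilt, hν]

theorem compProd_eq_of_distortion_eq_zero [IsMarkovKernel κ] (hl : ∀ j, 0 ≤ l j)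
    (hκ : distortion (gaussianSource l) κ = 0) :
    gaussianSource l ⊗ₘ κ = gaussianSource l ⊗ₘ gaussianEncoder l 0 := by
  rw [compProd_eq_map_of_distortion_eq_zero hκ, compProd_eq_map_of_distortion_eq_zero]
  rw [distortion_gaussianEncoder hl le_rfl]
  simp [hl]

theorem comp_eq_of_compProd_eq [IsMarkovKernel κ]
    (h : gaussianSource l ⊗ₘ κ = gaussianSource l ⊗ₘ gaussianEncoder l θ) :
    κ ∘ₘ gaussianSource l = gaussianEncoder l θ ∘ₘ gaussianSource l := by
  rw [← Measure.snd_compProd, h, Measure.snd_compProd]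

theorem isOptimalEncoding_gaussianEncoder (hl : ∀ j, 0 ≤ l j) (hθ : 0 ≤ θ) :
    IsOptimalEncoding (gaussianSource l) (∑ j, min θ (l j)) (gaussianEncoder l θ) := by
  refine ⟨inferInstance, (distortion_gaussianEncoder hl hθ).le, ?_⟩
  rcases hθ.eq_or_lt with rfl | hθ
  · refine le_antisymm (le_iInf₂ fun κ _ => le_iInf fun hκ => ?_)
      (iInf₂_le_of_le _ inferInstance (iInf_le _ (distortion_gaussianEncoder hl le_rfl).le))
    -- At zero distortion all admissible mappings share one joint law, so their mutual informations
    -- agree without being computed, even if infinite.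
    have h := compProd_eq_of_distortion_eq_zero (κ := κ) hl (by simpa [hl] using hκ)
    rw [mutualInfo, mutualInfo, h, comp_eq_of_compProd_eq h]
  · rw [mutualInfo_gaussianEncoder hl hθ, rate_gaussianSource hl hθ]

end Optimality

end RateDistortion

theorem lemma1 (n : ℕ) [NeZero n] (l : Fin n → ℝ) (hl : Antitone l) (hl0 : ∀ j, 0 ≤ l j)
    (δ : ℝ) (hδ : δ ∈ Set.Icc 0 (∑ j, l j)) :
    (∃! θ : ℝ, RateDistortion.IsReverseWaterFilling l δ θ) ∧
    ∀ θ : ℝ, RateDistortion.IsReverseWaterFilling l δ θ →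
      RateDistortion.IsOptimalEncoding (RateDistortion.gaussianSource l) δ
        (RateDistortion.gaussianEncoder l θ) ∧
      ∀ κ : Kernel (EuclideanSpace ℝ (Fin n)) (EuclideanSpace ℝ (Fin n)),
        RateDistortion.IsOptimalEncoding (RateDistortion.gaussianSource l) δ κ →
          (∀ᵐ β ∂(RateDistortion.gaussianSource l),
            κ β = RateDistortion.gaussianEncoder l θ β) ∧
          κ ∘ₘ RateDistortion.gaussianSource l =
            multivariateGaussian 0 (Matrix.diagonal l * RateDistortion.matS l θ) := by
  refine ⟨RateDistortion.existsUnique_isReverseWaterFilling hl hl0 hδ, ?_⟩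
  rintro θ ⟨⟨hθ, -⟩, rfl⟩
  refine ⟨RateDistortion.isOptimalEncoding_gaussianEncoder hl0 hθ, fun κ hκ => ?_⟩
  have := hκ.isMarkov
  have h : RateDistortion.gaussianSource l ⊗ₘ κ =
      RateDistortion.gaussianSource l ⊗ₘ RateDistortion.gaussianEncoder l θ := by
    rcases hθ.eq_or_lt with rfl | hθ
    · exact RateDistortion.compProd_eq_of_distortion_eq_zero hl0
        (by simpa [hl0] using hκ.distortion_le)
    · exact RateDistortion.compProd_eq_of_isOptimalEncoding hl0 hθ hκ
  exact ⟨RateDistortion.ae_eq_gaussianEncoder_of_compProd_eq h,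
    (RateDistortion.comp_eq_of_compProd_eq h).trans
      (RateDistortion.comp_gaussianEncoder hl0 hθ)⟩
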